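/- Fix a block $k$ of $T$ slots. The controllers of a wireless network are indexed by $j=0,1,2,\dots$; $j=0$ is the typical controller, whose actuator is at the origin of $\mathbb{R}^2$ at distance $r_0>0$ from it, and the remaining controllers (the interferers) form a homogeneous Poisson point process in $\mathbb{R}^2$ of density $\lambda>0$; $r_j$ is the distance of controller $j$ from the origin. At the beginning of block $k$ each controller has, with probability $P=P_{\mathrm{O}_{k-1}}$, already been block controllable at least once. Such a controller is in mode $\Phi_{\mathrm C}$; any other controller is in mode $\Phi_{\mathrm B}$ if it wins a lottery with success probability $\delta_{\mathrm B}$, and in mode $\Phi_{\mathrm S}$ otherwise. A controller in mode $\Phi_{\mathrm B}$ transmits in every slot of the block; one in mode $\Phi_{\mathrm S}$ (respectively $\Phi_{\mathrm C}$) transmits in each slot with probability $\delta_{\mathrm S}$ (respectively $\delta_{\mathrm C}$). The channel coefficients $h_j(t)$ from controller $j$ to the typical actuator are Rayleigh fading with unit mean power, i.e. $|h_j(t)|$ has density $2xe^{-x^2}$ on $[0,\infty)$. The interferer locations, the controllability states, all lotteries and all channel coefficients are independent. With $\mathbb{I}_j(S_t)\in\{0,1\}$ the indicator that controller $j$ transmits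 in slot $t$, transmit power $\xi>0$, noise power $N_o\ge 0$, path-loss exponent $\alpha>0$ and threshold $\gamma>0$, the SINR of the typical controller is $$\Upsilon(t)=\frac{\mathbb{I}_0(S_t)\,\xi|h_0(t)|^2r_0^{-\alpha}}{N_o+\sum_{j\ge1}\mathbb{I}_j(S_t)\,\xi|h_j(t)|^2r_j^{-\alpha}} .$$ Put $\lambda_{\mathrm B}=(1-P)\delta_{\mathrm B}\lambda$, $\lambda_{\mathrm S}=(1-P)(1-\delta_{\mathrm B})\delta_{\mathrm S}\lambda$, $\lambda_{\mathrm C}=P\delta_{\mathrm C}\lambda$ and $\lambda_{\mathrm{eff}}=\lambda_{\mathrm B}+\lambda_{\mathrm S}+\lambda_{\mathrm C}$. Then, for every slot $t$ of the block, the conditional slot success probability $\mathbb{P}(\Upsilon(t)>\gamma\mid \mathbb{I}_0(S_t)=1,\ \phi)$ of the typical controller has the same value $\varrho_k$ for every access mode $\phi\in\{\Phi_{\mathrm B},\Phi_{\mathrm S},\Phi_{\mathrm C}\}$ in which the typical controller transmits with positive probability, and also $\mathbb{P}(\Upsilon(t)>\gamma\mid \mathbb{I}_0(S_t)=1)=\varrho_k$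 if $\mathbb{P}(\mathbb{I}_0(S_t)=1)>0$, where $$\varrho_k=\exp\Big(-\frac{\gamma N_o}{\xi r_0^{-\alpha}}\Big)\exp\Big(-2\pi\lambda_{\mathrm{eff}}\int_0^\infty\frac{\gamma r^{-\alpha}}{r_0^{-\alpha}+\gamma r^{-\alpha}}\,r\,dr\Big).$$ The integral converges if $\alpha>2$. If $\alpha\le2$, it equals $+\infty$ and the formula is read with $\exp(-\infty)=0$, i.e. $\varrho_k=0$. -/

import Mathlib

open MeasureTheory ProbabilityTheory Set
open scoped ENNReal

noncomputable section

namespace WirelessControl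

/-- The plane, with the Euclidean norm and Lebesgue measure. -/
abbrev Plane : Type := EuclideanSpace ℝ (Fin 2)

/-- The Rayleigh distribution with mean square `m` (the law of `|h|` for a Rayleigh fading
coefficient `h` of mean power `m`): density `(2 x / m) exp (-x² / m)` on `[0, ∞)`. -/
def rayleighMeasure (m : ℝ) : Measure ℝ :=
  (volume.restrict (Ici 0)).withDensity
    (fun x => ENNReal.ofReal (2 * x / m * Real.exp (-(x ^ 2) / m)))

/-- The number of points of the enumerated random set `X 0, X 1, …` that lie in `B`. -/
def pointCount {Ω : Type*} (X : ℕ → Ω → Plane) (B : Set Plane) (ω : Ω) : ℕ∞ :=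
  Set.encard {j | X j ω ∈ B}

/-- The random points `X 0, X 1, …` form a homogeneous Poisson point process of density `lam > 0`
in the plane: the number of points in a Borel set of finite area is Poisson distributed with mean
`lam` times the area, and the numbers of points in disjoint sets are independent.  (For `lam > 0`
such a process almost surely has infinitely many points, so that it is enumerated by `ℕ`.) -/
structure IsPoissonPointProcess {Ω : Type*} [MeasurableSpace Ω] (μ : Measure Ω)
    (X : ℕ → Ω → Plane) (lam : ℝ) : Prop where
  measurable : ∀ j, Measurable (X j)
  law : ∀ B : Set Plane, MeasurableSet B → volume B ≠ ∞ →
    HasLaw (pointCount X B)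
      ((poissonMeasure (lam * volume.real B).toNNReal).map (Nat.cast : ℕ → ℕ∞)) μ
  indep : ∀ (n : ℕ) (B : Fin n → Set Plane), (∀ i, MeasurableSet (B i)) →
    (∀ i, volume (B i) ≠ ∞) → Pairwise (fun i i' => Disjoint (B i) (B i')) →
    iIndepFun (fun i => pointCount X (B i)) μ

/-- The three access modes of a controller during a block: block Aloha (`block`), slotted Aloha
before controllability (`slot`), and slotted Aloha after controllability (`post`). -/
inductive AccessMode where
  | block
  | slot
  | post

/-- The random quantities of the network during one block `k` of `T` slots.  Controllers are
indexed by `j : ℕ`, the typical controller is `j = 0`; the typical actuator is at the origin.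
The index `t : Fin T` stands for the slot `k T + t`.

* `pos j` is the location of controller `j`;
* `ctrl j` tells whether controller `j` was block controllable at least once up to block `k - 1`;
* `blockCoin j` is the outcome of the block-access lottery of controller `j`;
* `slotCoin j t`, `postCoin j t` are the outcomes of the slot-access lotteries of controller `j`
  in slot `t`, for use in the pre- and post-controllability slotted modes;
* `fading j t` is the channel coefficient from controller `j` to the typical actuator. -/
structure BlockNetwork (Ω : Type*) (T : ℕ) where
  pos : ℕ → Ω → Plane
  ctrl : ℕ → Ω → Bool
  blockCoin : ℕ → Ω → Bool
  slotCoin : ℕ → Fin T → Ω → Bool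
  postCoin : ℕ → Fin T → Ω → Bool
  fading : ℕ → Fin T → Ω → ℂ

/-- Labels of the independent sources of randomness: the interferer locations (as one source), and
each state, lottery and fading coefficient separately. -/
inductive Source (T : ℕ) where
  | locations
  | ctrl (j : ℕ)
  | blockCoin (j : ℕ)
  | slotCoin (j : ℕ) (t : Fin T)
  | postCoin (j : ℕ) (t : Fin T)
  | fading (j : ℕ) (t : Fin T)

namespace BlockNetwork

variable {Ω : Type*} {T : ℕ}

/-- The sigma-algebra generated by a source of randomness. -/
@[reducible] def sigma (N : BlockNetwork Ω T) : Source T → MeasurableSpace Ω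
  | .locations => ⨆ j : ℕ, MeasurableSpace.comap (N.pos (j + 1)) inferInstance
  | .ctrl j => MeasurableSpace.comap (N.ctrl j) inferInstance
  | .blockCoin j => MeasurableSpace.comap (N.blockCoin j) inferInstance
  | .slotCoin j t => MeasurableSpace.comap (N.slotCoin j t) inferInstance
  | .postCoin j t => MeasurableSpace.comap (N.postCoin j t) inferInstance
  | .fading j t => MeasurableSpace.comap (N.fading j t) inferInstance

/-- Controllers that have already been controllable are in mode `post`; the others are in mode
`block` if they win the block lottery and in mode `slot` otherwise. -/
def mode (N : BlockNetwork Ω T) (j : ℕ) (ω : Ω) : AccessMode :=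
  if N.ctrl j ω = true then .post
  else if N.blockCoin j ω = true then .block
  else .slot

/-- The access indicator of controller `j` in slot `t`: in mode `block` it always transmits, in
the slotted modes it transmits if it wins the slot lottery of its mode. -/
def transmits (N : BlockNetwork Ω T) (j : ℕ) (t : Fin T) (ω : Ω) : Bool :=
  match N.mode j ω with
  | .block => true
  | .slot => N.slotCoin j t ω
  | .post => N.postCoin j t ω

/-- The power received at the typical actuator from controller `j` in slot `t` (zero if it does
not transmit), for transmit power `ξ` and path-loss exponent `α`. -/
def receivedPower (N : BlockNetwork Ω T) (ξ α : ℝ) (j : ℕ) (t : Fin T) (ω : Ω) : ℝ :=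
  (if N.transmits j t ω = true then 1 else 0) * ξ * ‖N.fading j t ω‖ ^ 2 * ‖N.pos j ω‖ ^ (-α)

/-- The SINR of the typical controller in slot `t`.  It takes values in `[0, ∞]`, so that the sum
over the infinitely many interferers always makes sense. -/
def sinr (N : BlockNetwork Ω T) (ξ No α : ℝ) (t : Fin T) (ω : Ω) : ℝ≥0∞ :=
  ENNReal.ofReal (N.receivedPower ξ α 0 t ω) /
    (ENNReal.ofReal No + ∑' j : ℕ, ENNReal.ofReal (N.receivedPower ξ α (j + 1) t ω))

variable [MeasurableSpace Ω]

/-- The controllability state probability: the probability that the typical controller was block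
controllable at least once before the current block. -/
def stateProb (N : BlockNetwork Ω T) (μ : Measure Ω) : ℝ := μ.real {ω | N.ctrl 0 ω = true}

/-- Density of the transmitting controllers in mode `block`. -/
def lambdaB (N : BlockNetwork Ω T) (μ : Measure Ω) (lam δB : ℝ) : ℝ :=
  (1 - N.stateProb μ) * δB * lam

/-- Density of the transmitting controllers in mode `slot`. -/
def lambdaS (N : BlockNetwork Ω T) (μ : Measure Ω) (lam δB δS : ℝ) : ℝ :=
  (1 - N.stateProb μ) * (1 - δB) * δS * lam

/-- Density of the transmitting controllers in mode `post`. -/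
def lambdaC (N : BlockNetwork Ω T) (μ : Measure Ω) (lam δC : ℝ) : ℝ :=
  N.stateProb μ * δC * lam

/-- Total density of the transmitting controllers. -/
def lambdaEff (N : BlockNetwork Ω T) (μ : Measure Ω) (lam δB δS δC : ℝ) : ℝ :=
  N.lambdaB μ lam δB + N.lambdaS μ lam δB δS + N.lambdaC μ lam δC

/-- The network model in a block: the typical controller is at distance `r0` from its actuator, the
other controllers form a Poisson point process of density `lam`; every controller has the same
controllability state probability; the lotteries have success probabilities `δB`, `δS`, `δC`; the
fading amplitudes are Rayleigh distributed with unit mean power; and the interferer locations, the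
states, the lotteries and the fading coefficients are all independent. -/
structure IsModel (N : BlockNetwork Ω T) (μ : Measure Ω) (r0 lam δB δS δC : ℝ) : Prop where
  pos_zero : ∀ ω, ‖N.pos 0 ω‖ = r0
  poisson : IsPoissonPointProcess μ (fun j => N.pos (j + 1)) lam
  measurable_ctrl : ∀ j, Measurable (N.ctrl j)
  measurable_blockCoin : ∀ j, Measurable (N.blockCoin j)
  measurable_slotCoin : ∀ j t, Measurable (N.slotCoin j t)
  measurable_postCoin : ∀ j t, Measurable (N.postCoin j t)
  measurable_fading : ∀ j t, Measurable (N.fading j t)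
  ctrl_prob : ∀ j, μ.real {ω | N.ctrl j ω = true} = N.stateProb μ
  blockCoin_prob : ∀ j, μ.real {ω | N.blockCoin j ω = true} = δB
  slotCoin_prob : ∀ j t, μ.real {ω | N.slotCoin j t ω = true} = δS
  postCoin_prob : ∀ j t, μ.real {ω | N.postCoin j t ω = true} = δC
  fading_law : ∀ j t, HasLaw (fun ω => ‖N.fading j t ω‖) (rayleighMeasure 1) μ
  indep : iIndep N.sigma μ

end BlockNetwork

/-- The integrand of the interference integral,
`γ r^(-α) / (r0^(-α) + γ r^(-α)) · r`. -/
def interferenceIntegrand (γ α r0 r : ℝ) : ℝ :=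
  γ * r ^ (-α) / (r0 ^ (-α) + γ * r ^ (-α)) * r

end WirelessControl

end

/-! When the typical controller transmits, `Υ > γ` says that `|h_0|²` exceeds `γ r0^α (No + I) / ξ`,
where `I` is the interference. Since `|h_0|²` is exponential and independent of `I`, integrating it
out turns the success probability into `E exp (-γ r0^α (No + I) / ξ)`: the noise factor times the
Laplace transform of `I`. The access variables of controller 0 are independent of `h_0` and `I`, so
the probability of any conditioning event built from them cancels. This is why all modes share one
value (`measure_inter_success`, `cond_success`).

The interference is a sum over a Poisson process with independent marks, a silent controller having
mark 0; no thinned process is constructed. With the locations frozen, the marks integrate to a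
product of factors `u (g (X j))`, where `u` is the common Laplace transform of the marks. Writing
each factor as `exp (-(-log u))` reduces the marked case to the Laplace functional `E exp (-∑ f (X
j)) = exp (-lam ∫ (1 - exp (-f)))`. Here `1 - u ∘ g` is the transmission probability `p` times the
interference ratio, and `lam * p` is `lambdaEff`; polar coordinates give the stated integral.

All of this takes place in `[0, ∞]` with `exp (-∞) = 0`, so neither the convergence of the
interference nor that of the integral is needed until the two ranges of `α` are separated at the
very end. -/

namespace WirelessControl

/-! ### The exponential on `[0, ∞]` and the Laplace transform of the Poisson law -/

/-- The function `x ↦ exp (-x)` on `[0, ∞]`, with `exp (-∞) = 0`. -/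
noncomputable def expNeg (x : ℝ≥0∞) : ℝ≥0∞ := EReal.exp (-(x : EReal))

lemma continuous_expNeg : Continuous expNeg :=
  ENNReal.continuous_exp.comp (continuous_neg.comp continuous_coe_ennreal_ereal)

@[fun_prop] lemma measurable_expNeg : Measurable expNeg := continuous_expNeg.measurable

lemma antitone_expNeg : Antitone expNeg := fun x y h => by
  simpa [expNeg] using h

@[simp] lemma expNeg_zero : expNeg 0 = 1 := by simp [expNeg]

@[simp] lemma expNeg_top : expNeg ∞ = 0 := by simp [expNeg]

lemma expNeg_le_one (x : ℝ≥0∞) : expNeg x ≤ 1 := by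
  simpa using antitone_expNeg (zero_le (a := x))

lemma expNeg_ofReal {x : ℝ} (hx : 0 ≤ x) :
    expNeg (ENNReal.ofReal x) = ENNReal.ofReal (Real.exp (-x)) := by
  rw [expNeg, EReal.coe_ennreal_ofReal, max_eq_left hx, ← EReal.coe_neg, EReal.exp_coe]

lemma expNeg_add (x y : ℝ≥0∞) : expNeg (x + y) = expNeg x * expNeg y := by
  rw [expNeg, EReal.coe_ennreal_add, EReal.neg_add, sub_eq_add_neg, EReal.exp_add]
  · rfl
  · simp
  · simp

lemma expNeg_sum {ι : Type*} (s : Finset ι) (f : ι → ℝ≥0∞) :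
    expNeg (∑ i ∈ s, f i) = ∏ i ∈ s, expNeg (f i) := by
  classical
  induction s using Finset.induction_on with
  | empty => simp
  | insert i s hi ih => rw [Finset.sum_insert hi, Finset.prod_insert hi, expNeg_add, ih]

lemma expNeg_nsmul (n : ℕ) (x : ℝ≥0∞) : expNeg (n * x) = expNeg x ^ n := by
  simpa using expNeg_sum (Finset.range n) (fun _ => x)

/-- Divergent series are included: every series converges in `[0, ∞]`, and `expNeg` is continuous at
`∞` too. -/
lemma tendsto_prod_expNeg (f : ℕ → ℝ≥0∞) :
    Filter.Tendsto (fun n => ∏ i ∈ Finset.range n, expNeg (f i)) Filter.atTop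
      (nhds (expNeg (∑' i, f i))) := by
  simp_rw [← expNeg_sum]
  exact (continuous_expNeg.tendsto _).comp ENNReal.summable.hasSum.tendsto_sum_nat

/-- A right inverse of `expNeg` on `[0, 1]`. -/
noncomputable def negLog (y : ℝ≥0∞) : ℝ≥0∞ := (-(ENNReal.log y)).toENNReal

lemma measurable_negLog : Measurable negLog :=
  (continuous_neg.measurable.comp ENNReal.measurable_log).ereal_toENNReal

lemma expNeg_negLog {y : ℝ≥0∞} (hy : y ≤ 1) : expNeg (negLog y) = y := by
  rw [expNeg, negLog, EReal.coe_toENNReal, neg_neg, ENNReal.exp_log]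
  rw [EReal.neg_nonneg]
  simpa using ENNReal.log_monotone hy

lemma lintegral_poissonMeasure (r : NNReal) (f : ℕ → ℝ≥0∞) :
    ∫⁻ n, f n ∂(poissonMeasure r) =
      ∑' n, ENNReal.ofReal (Real.exp (-r) * r ^ n / n.factorial) * f n := by
  simp [poissonMeasure, lintegral_sum_measure, lintegral_smul_measure]

/-- With `y = expNeg c` the left side is the Poisson generating function at `y`, summed by the
exponential series at `r * y`. -/
lemma lintegral_expNeg_poissonMeasure (r : NNReal) (c : ℝ≥0∞) :
    ∫⁻ n : ℕ, expNeg (n * c) ∂(poissonMeasure r) = expNeg (r * (1 - expNeg c)) := by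
  obtain ⟨y, hy⟩ : ∃ y : NNReal, expNeg c = y := 
    ⟨(expNeg c).toNNReal, (ENNReal.coe_toNNReal ((expNeg_le_one c).trans_lt ENNReal.one_lt_top).ne).symm⟩
  have hy1 : y ≤ 1 := by exact_mod_cast hy ▸ expNeg_le_one c
  have hs : HasSum (fun n : ℕ => Real.exp (-r) * ((r * y : ℝ) ^ n / n.factorial))
      (Real.exp (-r) * Real.exp (r * y)) :=
    HasSum.mul_left _ (by
      rw [Real.exp_eq_exp_ℝ]; exact NormedSpace.expSeries_div_hasSum_exp (r * y : ℝ))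
  have h0 : (r : ℝ≥0∞) * (1 - expNeg c) = ENNReal.ofReal ((r : ℝ) * (1 - (y : ℝ))) := by
    rw [hy, ENNReal.ofReal_mul r.coe_nonneg, ENNReal.ofReal_sub _ y.coe_nonneg]
    simp
  rw [lintegral_poissonMeasure, h0, expNeg_ofReal (mul_nonneg r.coe_nonneg (sub_nonneg.2 (by exact_mod_cast hy1)))]
  rw [show Real.exp (-((r : ℝ) * (1 - (y : ℝ)))) = Real.exp (-(r : ℝ)) * Real.exp (r * y) by
    rw [← Real.exp_add]; ring_nf, ← hs.tsum_eq, ENNReal.ofReal_tsum_of_nonneg (fun n => by positivity) hs.summable]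
  refine tsum_congr fun n => ?_
  rw [expNeg_nsmul, hy, ← ENNReal.ofReal_coe_nnreal, ← ENNReal.ofReal_pow y.coe_nonneg, ← ENNReal.ofReal_mul (by positivity)]
  congr 1
  rw [mul_pow]; ring

/-! ### The Laplace functional of a Poisson point process -/

section Poisson

variable {Ω : Type*}

lemma tsum_indicator_eq_pointCount (X : ℕ → Ω → Plane) (B : Set Plane) (ω : Ω) :
    ∑' j, B.indicator (1 : Plane → ℝ≥0∞) (X j ω) = (pointCount X B ω : ℝ≥0∞) := by
  rw [pointCount, ← ENNReal.tsum_set_one]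
  exact (tsum_subtype {j | X j ω ∈ B} fun _ => (1 : ℝ≥0∞)).symm

/-- Group the points by the value of `f`. The value 0 is left out because its level set may have
infinite area, where the law of the count is not specified. -/
lemma tsum_simpleFunc_eq_sum_pointCount (X : ℕ → Ω → Plane) (f : SimpleFunc Plane ℝ≥0∞) (ω : Ω) :
    ∑' j, f (X j ω) = ∑ c ∈ f.range.filter (· ≠ 0), (pointCount X (f ⁻¹' {c}) ω : ℝ≥0∞) * c := by
  classical
  have h (x : Plane) :
      f x = ∑ c ∈ f.range.filter (· ≠ 0), (f ⁻¹' {c}).indicator (1 : Plane → ℝ≥0∞) x * c := by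
    by_cases hx : f x = 0
    · rw [hx]; symm
      refine Finset.sum_eq_zero fun c hc => ?_
      have : x ∉ f ⁻¹' {c} := fun h => (Finset.mem_filter.1 hc).2 (by rw [← hx]; exact h.symm)
      simp [indicator_of_notMem this]
    · rw [Finset.sum_eq_single (f x)]
      · simp
      · intro c _ hcx
        have : x ∉ f ⁻¹' {c} := fun h => hcx h.symm
        simp [indicator_of_notMem this]
      · intro h; simp [hx] at h
  simp_rw [← tsum_indicator_eq_pointCount, ← ENNReal.tsum_mul_right]
  rw [← Summable.tsum_finsetSum (fun _ _ => ENNReal.summable)]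
  exact tsum_congr fun j => h _

variable [MeasurableSpace Ω] {μ : Measure Ω} {X : ℕ → Ω → Plane} {lam : ℝ}

namespace IsPoissonPointProcess

lemma measurable_pointCount (hX : IsPoissonPointProcess μ X lam) {B : Set Plane}
    (hB : MeasurableSet B) : Measurable fun ω => (pointCount X B ω : ℝ≥0∞) := by
  simp_rw [← tsum_indicator_eq_pointCount]
  exact Measurable.tsum fun j => (measurable_one.indicator hB).comp (hX.measurable j)

lemma lintegral_expNeg_pointCount (hX : IsPoissonPointProcess μ X lam) (hlam : 0 ≤ lam)
    {B : Set Plane} (hB : MeasurableSet B) (hB' : volume B ≠ ∞) (c : ℝ≥0∞) :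
    ∫⁻ ω, expNeg (pointCount X B ω * c) ∂μ =
      expNeg (ENNReal.ofReal lam * ((1 - expNeg c) * volume B)) := by
  have h := hX.law B hB hB'
  have h1 : ∫⁻ ω, expNeg (pointCount X B ω * c) ∂μ =
      ∫⁻ k : ℕ∞, expNeg (k * c) ∂(μ.map (pointCount X B)) :=
    (lintegral_map' (f := fun k : ℕ∞ => expNeg (k * c)) Measurable.of_discrete.aemeasurable
      h.aemeasurable).symm
  rw [h1, h.map_eq, lintegral_map (by fun_prop) (by fun_prop)]
  simp only [ENat.toENNReal_coe]
  rw [lintegral_expNeg_poissonMeasure]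
  congr 1
  rw [← ENNReal.ofReal, ENNReal.ofReal_mul hlam, Measure.real, ENNReal.ofReal_toReal hB', mul_assoc,
    mul_comm (volume B)]

/-- The level sets of nonzero values are disjoint and of finite area, so their counts are
independent Poisson variables and the expectation factorizes. -/
lemma lintegral_expNeg_tsum_simpleFunc (hX : IsPoissonPointProcess μ X lam) (hlam : 0 ≤ lam)
    (f : SimpleFunc Plane ℝ≥0∞) (hf : f.FinMeasSupp volume) :
    ∫⁻ ω, expNeg (∑' j, f (X j ω)) ∂μ =
      expNeg (ENNReal.ofReal lam * ∫⁻ x, (1 - expNeg (f x))) := by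
  classical
  set s := f.range.filter (· ≠ 0) with hs
  have hfin (c : s) : volume (f ⁻¹' {(c : ℝ≥0∞)}) ≠ ∞ :=
    (hf.meas_preimage_singleton_ne_zero (Finset.mem_filter.1 c.2).2).ne
  let e := s.equivFin.symm
  have hind := hX.indep s.card (fun i => f ⁻¹' {((e i : s) : ℝ≥0∞)})
    (fun i => f.measurableSet_fiber _) (fun i => hfin _) (fun i j hij =>
      Disjoint.preimage f (by
        rw [disjoint_singleton]
        exact fun h => hij (e.injective (Subtype.ext h))))
  have hind' := hind.comp (fun i k => expNeg ((k : ℝ≥0∞) * ((e i : s) : ℝ≥0∞)))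
    (fun i => by fun_prop)
  have hR : ∫⁻ x, (1 - expNeg (f x)) = ∑ c ∈ s, (1 - expNeg c) * volume (f ⁻¹' {c}) := by
    change ∫⁻ x, (f.map (fun c => 1 - expNeg c)) x = _
    rw [SimpleFunc.lintegral_eq_lintegral, SimpleFunc.map_lintegral, hs, Finset.sum_filter]
    refine Finset.sum_congr rfl fun c _ => ?_
    split_ifs with hc
    · rfl
    · simp [not_not.1 hc]
  have hprod (g : ℝ≥0∞ → ℝ≥0∞) : ∏ c ∈ s, g c = ∏ i, g (e i) := by
    rw [← Finset.prod_coe_sort s, ← e.prod_comp]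
  simp_rw [tsum_simpleFunc_eq_sum_pointCount, expNeg_sum]
  rw [hR, Finset.mul_sum, expNeg_sum]
  simp_rw [← hs, hprod]
  refine (lintegral_prod_eq_prod_lintegral_of_indepFun Finset.univ _ hind' fun i => ?_).trans ?_
  · exact measurable_expNeg.comp ((hX.measurable_pointCount (f.measurableSet_fiber _)).mul_const _)
  · exact Finset.prod_congr rfl fun i _ =>
      hX.lintegral_expNeg_pointCount hlam (f.measurableSet_fiber _) (hfin _) _

/-- The Laplace functional of a homogeneous Poisson point process. -/
theorem lintegral_expNeg_tsum [IsProbabilityMeasure μ]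
    (hX : IsPoissonPointProcess μ X lam) (hlam : 0 ≤ lam)
    {f : Plane → ℝ≥0∞} (hf : Measurable f) :
    ∫⁻ ω, expNeg (∑' j, f (X j ω)) ∂μ =
      expNeg (ENNReal.ofReal lam * ∫⁻ x, (1 - expNeg (f x))) := by
  -- Cutting off to balls of radius `n` gives the approximants finite-measure support while keeping
  -- them monotone in `n`.
  let g (n : ℕ) : SimpleFunc Plane ℝ≥0∞ := (SimpleFunc.eapprox f n).restrict (Metric.ball 0 n)
  have hgm : Monotone fun n => (g n : Plane → ℝ≥0∞) := by
    intro m n hmn x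
    simp only [g, SimpleFunc.restrict_apply _ Metric.isOpen_ball.measurableSet]
    refine (indicator_le_indicator (SimpleFunc.monotone_eapprox f hmn x)).trans
      (indicator_le_indicator_of_subset (Metric.ball_subset_ball (by exact_mod_cast hmn))
        (fun _ => zero_le) x)
  have hgt (x : Plane) : Filter.Tendsto (fun n => g n x) Filter.atTop (nhds (f x)) := by
    refine (SimpleFunc.tendsto_eapprox hf x).congr' ?_
    obtain ⟨n, hn⟩ := exists_nat_gt ‖x‖
    filter_upwards [Filter.eventually_ge_atTop n] with m hm
    rw [SimpleFunc.restrict_apply _ Metric.isOpen_ball.measurableSet, indicator_of_mem]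
    rw [mem_ball_zero_iff]
    exact hn.trans_le (by exact_mod_cast hm)
  have hgf (n : ℕ) : (g n).FinMeasSupp volume := by
    rw [SimpleFunc.finMeasSupp_iff_support]
    refine (measure_mono ?_).trans_lt (measure_ball_lt_top (x := (0 : Plane)) (r := n))
    intro x hx
    by_contra h
    refine hx ?_
    simp only [g]
    rw [SimpleFunc.restrict_apply _ Metric.isOpen_ball.measurableSet, indicator_of_notMem h]
  have hsup (x : Plane) : ⨆ n, g n x = f x :=
    iSup_eq_of_tendsto (fun m n h => hgm h x) (hgt x)
  have hL : Filter.Tendsto (fun n => ∫⁻ ω, expNeg (∑' j, g n (X j ω)) ∂μ) Filter.atTop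
      (nhds (∫⁻ ω, expNeg (∑' j, f (X j ω)) ∂μ)) := by
    refine tendsto_lintegral_of_dominated_convergence (fun _ => 1) (fun n => ?_) (fun n => ?_)
      (by simp) ?_
    · exact measurable_expNeg.comp (Measurable.tsum fun j =>
        (g n).measurable.comp (hX.measurable j))
    · exact Filter.Eventually.of_forall fun ω => expNeg_le_one _
    · refine Filter.Eventually.of_forall fun ω => (continuous_expNeg.tendsto _).comp ?_
      -- Read as integrals against the counting measure, the sums over points converge by monotone
      -- convergence.
      simp_rw [← lintegral_count]
      exact lintegral_tendsto_of_tendsto_of_monotone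
        (fun n => (measurable_of_countable _).aemeasurable)
        (Filter.Eventually.of_forall fun j m n h => hgm h _)
        (Filter.Eventually.of_forall fun j => hgt _)
  have hR : Filter.Tendsto (fun n => expNeg (ENNReal.ofReal lam * ∫⁻ x, (1 - expNeg (g n x))))
      Filter.atTop (nhds (expNeg (ENNReal.ofReal lam * ∫⁻ x, (1 - expNeg (f x))))) := by
    refine (continuous_expNeg.tendsto _).comp (ENNReal.Tendsto.const_mul ?_ (Or.inr ENNReal.ofReal_ne_top))
    refine lintegral_tendsto_of_tendsto_of_monotone (fun n => ?_) ?_ ?_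
    · exact (measurable_const.sub (measurable_expNeg.comp (g n).measurable)).aemeasurable
    · exact Filter.Eventually.of_forall fun x m n h => tsub_le_tsub_left (antitone_expNeg (hgm h x)) _
    · refine Filter.Eventually.of_forall fun x => ?_
      exact ENNReal.Tendsto.sub tendsto_const_nhds ((continuous_expNeg.tendsto _).comp (hgt x))
        (Or.inl ENNReal.one_ne_top)
  refine tendsto_nhds_unique hL (hR.congr fun n => ?_)
  exact (hX.lintegral_expNeg_tsum_simpleFunc hlam (g n) (hgf n)).symm

end IsPoissonPointProcess
end Poisson
-- Independent marks
section Marked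

variable {Ω : Type*} [MeasurableSpace Ω] {μ : Measure Ω} {X : ℕ → Ω → Plane} {lam : ℝ}

/-- The Laplace functional of a homogeneous Poisson point process with independent marks, where
`u` is the Laplace transform of the marks. -/
theorem IsPoissonPointProcess.lintegral_expNeg_tsum_mul [IsProbabilityMeasure μ]
    (hX : IsPoissonPointProcess μ X lam) (hlam : 0 ≤ lam)
    {M : ℕ → Ω → ℝ≥0∞} (hM : ∀ j, Measurable (M j))
    (hXM : IndepFun (fun ω j => X j ω) (fun ω j => M j ω) μ)
    {u : ℝ≥0∞ → ℝ≥0∞} (hu : Measurable u) (hu1 : ∀ c, u c ≤ 1)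
    (hMu : ∀ (n : ℕ) (c : ℕ → ℝ≥0∞), (∀ j, c j ≠ ∞) →
      ∫⁻ ω, ∏ j ∈ Finset.range n, expNeg (M j ω * c j) ∂μ = ∏ j ∈ Finset.range n, u (c j))
    {g : Plane → ℝ≥0∞} (hg : Measurable g) (hg' : ∀ x, g x ≠ ∞) :
    ∫⁻ ω, expNeg (∑' j, M j ω * g (X j ω)) ∂μ =
      expNeg (ENNReal.ofReal lam * ∫⁻ x, (1 - u (g x))) := by
  have hXm : Measurable fun ω j => X j ω := measurable_pi_lambda _ hX.measurable
  have hMm : Measurable fun ω j => M j ω := measurable_pi_lambda _ hM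
  have hF : Measurable fun q : (ℕ → Plane) × (ℕ → ℝ≥0∞) => expNeg (∑' j, q.2 j * g (q.1 j)) :=
    measurable_expNeg.comp (Measurable.tsum fun j => by fun_prop)
  -- Only the independence of the whole mark sequence from the whole location sequence is used, so
  -- the order in which the points are enumerated is irrelevant. For frozen locations the finite
  -- products of `u` converge to a single exponential, with exponent `∑ negLog (u (g (x j)))`.
  have hinner (x : ℕ → Plane) :
      ∫⁻ m, expNeg (∑' j, m j * g (x j)) ∂(μ.map fun ω j => M j ω) =
        expNeg (∑' j, negLog (u (g (x j)))) := by
    have hm : Measurable fun m : ℕ → ℝ≥0∞ => expNeg (∑' j, m j * g (x j)) :=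
      measurable_expNeg.comp (Measurable.tsum fun j => by fun_prop)
    rw [lintegral_map hm hMm]
    have h1 : Filter.Tendsto (fun n => ∫⁻ ω, ∏ j ∈ Finset.range n, expNeg (M j ω * g (x j)) ∂μ)
        Filter.atTop (nhds (∫⁻ ω, expNeg (∑' j, M j ω * g (x j)) ∂μ)) := by
      refine tendsto_lintegral_of_dominated_convergence (fun _ => 1) (fun n => ?_) (fun n => ?_)
        (by simp) (Filter.Eventually.of_forall fun ω => tendsto_prod_expNeg _)
      · exact Finset.measurable_fun_prod _ fun j _ => measurable_expNeg.comp ((hM j).mul_const _)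
      · exact Filter.Eventually.of_forall fun ω => Finset.prod_le_one' fun j _ => expNeg_le_one _
    have h2 := tendsto_prod_expNeg fun j => negLog (u (g (x j)))
    simp_rw [expNeg_negLog (hu1 _)] at h2
    exact tendsto_nhds_unique (h1.congr fun n => hMu n _ fun j => hg' _) h2
  calc ∫⁻ ω, expNeg (∑' j, M j ω * g (X j ω)) ∂μ
      = ∫⁻ q, expNeg (∑' j, q.2 j * g (q.1 j)) ∂(μ.map fun ω => (fun j => X j ω, fun j => M j ω)) :=
        (lintegral_map hF (hXm.prodMk hMm)).symm
    _ = ∫⁻ ω, expNeg (∑' j, negLog (u (g (X j ω)))) ∂μ := by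
        have := Measure.isProbabilityMeasure_map (μ := μ) hMm.aemeasurable
        have := Measure.isProbabilityMeasure_map (μ := μ) hXm.aemeasurable
        rw [hXM.map_prod_eq_prod_map_map hXm.aemeasurable hMm.aemeasurable,
          lintegral_prod _ hF.aemeasurable]
        simp_rw [hinner]
        have hm : Measurable fun x : ℕ → Plane => expNeg (∑' j, negLog (u (g (x j)))) :=
          measurable_expNeg.comp (Measurable.tsum fun j =>
            measurable_negLog.comp (hu.comp (hg.comp (measurable_pi_apply j))))
        exact lintegral_map hm hXm
    _ = _ := by
        rw [hX.lintegral_expNeg_tsum hlam (f := fun x => negLog (u (g x)))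
          (measurable_negLog.comp (hu.comp hg))]
        simp_rw [expNeg_negLog (hu1 _)]

end Marked

/-! ### Rayleigh fading -/

section Rayleigh

/-- An explicit antiderivative is `-exp (-b x²) / b`. The case `b = 1` yields the tail of the
squared amplitude, the case `a = 0`, `b = 1 + s` its Laplace transform. -/
lemma lintegral_Ici_two_mul_exp {a b : ℝ} (ha : 0 ≤ a) (hb : 0 < b) :
    ∫⁻ x in Ici a, ENNReal.ofReal (2 * x * Real.exp (-(b * x ^ 2))) =
      ENNReal.ofReal (Real.exp (-(b * a ^ 2)) / b) := by
  have hd (x : ℝ) : HasDerivAt (fun x => -(Real.exp (-(b * x ^ 2)) / b))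
      (2 * x * Real.exp (-(b * x ^ 2))) x := by
    have h := ((((hasDerivAt_pow 2 x).const_mul b).neg.exp).div_const b).neg
    refine h.congr_deriv ?_
    simp only [Pi.neg_apply]
    field_simp
    ring_nf
  have hnn (x : ℝ) (hx : x ∈ Ioi a) : 0 ≤ 2 * x * Real.exp (-(b * x ^ 2)) := by
    have : 0 ≤ x := ha.trans (le_of_lt hx)
    positivity
  have ht : Filter.Tendsto (fun x : ℝ => -(Real.exp (-(b * x ^ 2)) / b)) Filter.atTop (nhds 0) := by
    have : Filter.Tendsto (fun x : ℝ => b * x ^ 2) Filter.atTop Filter.atTop :=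
      (Filter.tendsto_pow_atTop two_ne_zero).const_mul_atTop hb
    simpa using ((Real.tendsto_exp_neg_atTop_nhds_zero.comp this).div_const b).neg
  rw [setLIntegral_congr Ioi_ae_eq_Ici.symm,
    ← ofReal_integral_eq_lintegral_ofReal
      (integrableOn_Ioi_deriv_of_nonneg' (fun x _ => hd x) hnn ht)
      ((ae_restrict_mem measurableSet_Ioi).mono hnn),
    integral_Ioi_of_hasDerivAt_of_nonneg' (fun x _ => hd x) hnn ht]
  simp

lemma lintegral_rayleighMeasure_one {f : ℝ → ℝ≥0∞} (hf : Measurable f) :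
    ∫⁻ x, f x ∂(rayleighMeasure 1) =
      ∫⁻ x in Ici 0, ENNReal.ofReal (2 * x * Real.exp (-(x ^ 2))) * f x := by
  rw [rayleighMeasure, lintegral_withDensity_eq_lintegral_mul _ (by fun_prop) hf]
  simp

/-- The square of a Rayleigh variable of unit mean power is exponentially distributed. -/
lemma rayleighMeasure_one_tail {K : ℝ} (hK : 0 < K) (y : ℝ≥0∞) :
    rayleighMeasure 1 {x | y < ENNReal.ofReal (K * x ^ 2)} = expNeg (y * ENNReal.ofReal K⁻¹) := by
  rcases eq_or_ne y ∞ with rfl | hy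
  · simp [ENNReal.top_mul, hK]
  have hm : MeasurableSet {x : ℝ | y < ENNReal.ofReal (K * x ^ 2)} :=
    measurableSet_lt measurable_const (by fun_prop)
  set a := √(y.toReal * K⁻¹) with ha
  -- The law charges only `[0, ∞)`, where the event is `x > √(y / K)`; negative `x` satisfying the
  -- inequality do not count.
  have hset : {x : ℝ | y < ENNReal.ofReal (K * x ^ 2)} ∩ Ici 0 = Ioi a := by
    ext x
    simp only [mem_inter_iff, mem_ofPred_eq, mem_Ici, mem_Ioi]
    rw [ENNReal.lt_ofReal_iff_toReal_lt hy, ← div_lt_iff₀' hK, div_eq_mul_inv]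
    constructor
    · rintro ⟨h, hx⟩
      simpa [ha, Real.sqrt_sq hx] using Real.sqrt_lt_sqrt (by positivity) h
    · intro h
      have hx := (Real.sqrt_nonneg _).trans_lt h
      exact ⟨(Real.sqrt_lt' hx).1 h, hx.le⟩
  rw [rayleighMeasure, withDensity_apply _ hm, Measure.restrict_restrict hm, hset,
    setLIntegral_congr Ioi_ae_eq_Ici]
  have h := lintegral_Ici_two_mul_exp (Real.sqrt_nonneg (y.toReal * K⁻¹)) one_pos
  simp only [one_mul, div_one] at h ⊢
  rw [h, Real.sq_sqrt (by positivity), ← expNeg_ofReal (by positivity),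
    ENNReal.ofReal_mul (by positivity), ENNReal.ofReal_toReal hy]

lemma lintegral_expNeg_rayleighMeasure_one {s : ℝ} (hs : 0 ≤ s) :
    ∫⁻ x, expNeg (ENNReal.ofReal (s * x ^ 2)) ∂(rayleighMeasure 1) =
      ENNReal.ofReal (1 / (1 + s)) := by
  rw [lintegral_rayleighMeasure_one (by fun_prop)]
  have h := lintegral_Ici_two_mul_exp le_rfl (show 0 < 1 + s by positivity)
  simp only [ne_eq, OfNat.ofNat_ne_zero, not_false_eq_true, zero_pow, mul_zero, neg_zero,
    Real.exp_zero] at h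
  rw [← h]
  refine setLIntegral_congr_fun measurableSet_Ici fun x hx => ?_
  have hx : 0 ≤ x := hx
  rw [expNeg_ofReal (by positivity), ← ENNReal.ofReal_mul (by positivity), mul_assoc, ← Real.exp_add]
  ring_nf

end Rayleigh

/-! ### The interference integral in the two ranges of `α` -/

section Interference

variable {γ α r0 : ℝ}

lemma measurable_interferenceIntegrand : Measurable (interferenceIntegrand γ α r0) := by
  unfold interferenceIntegrand
  fun_prop

lemma interferenceIntegrand_nonneg (hγ : 0 < γ) (hr0 : 0 < r0) {r : ℝ} (hr : 0 ≤ r) :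
    0 ≤ interferenceIntegrand γ α r0 r := by
  unfold interferenceIntegrand
  positivity

/-- On `(0, 1]` the ratio is at most 1, so the pole of the path loss is harmless. Beyond 1, dropping
`γ r^(-α)` from the denominator leaves a multiple of `r^(1 - α)`. -/
lemma integrableOn_interferenceIntegrand (hγ : 0 < γ) (hr0 : 0 < r0) (hα : 2 < α) :
    IntegrableOn (interferenceIntegrand γ α r0) (Ioi 0) := by
  rw [← Ioc_union_Ioi_eq_Ioi zero_le_one]
  refine IntegrableOn.union ?_ ?_
  · refine Integrable.mono' (g := fun _ => (1 : ℝ)) (by simp)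
      measurable_interferenceIntegrand.aestronglyMeasurable ?_
    filter_upwards [ae_restrict_mem measurableSet_Ioc] with r hr
    have hr0' : 0 < r := hr.1
    rw [Real.norm_of_nonneg (interferenceIntegrand_nonneg hγ hr0 hr.1.le), interferenceIntegrand]
    refine mul_le_one₀ ?_ hr.1.le hr.2
    rw [div_le_one (by positivity)]
    have : 0 < r0 ^ (-α) := by positivity
    linarith
  · refine Integrable.mono' (g := fun r => γ / r0 ^ (-α) * r ^ (1 - α))
      ((integrableOn_Ioi_rpow_of_lt (by linarith) one_pos).const_mul _)
      measurable_interferenceIntegrand.aestronglyMeasurable ?_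
    filter_upwards [ae_restrict_mem measurableSet_Ioi] with r hr
    have hr' : 0 < r := one_pos.trans hr
    rw [Real.norm_of_nonneg (interferenceIntegrand_nonneg hγ hr0 hr'.le), interferenceIntegrand]
    rw [sub_eq_neg_add, Real.rpow_add hr', Real.rpow_one, ← mul_assoc,
      div_mul_eq_mul_div γ (r0 ^ (-α))]
    have : 0 < γ * r ^ (-α) := by positivity
    have : r0 ^ (-α) ≤ r0 ^ (-α) + γ * r ^ (-α) := by linarith
    exact mul_le_mul_of_nonneg_right
      (div_le_div_of_nonneg_left (by positivity) (by positivity) this) hr'.le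

/-- For `r > 1` the denominator is at most `r0^(-α) + γ`, so the integrand dominates a multiple of
`r^(1 - α)`, hence of `1 / r`. -/
lemma not_integrableOn_interferenceIntegrand (hγ : 0 < γ) (hr0 : 0 < r0) (hα0 : 0 < α)
    (hα : α ≤ 2) : ¬ IntegrableOn (interferenceIntegrand γ α r0) (Ioi 0) := by
  intro h
  have h1 := h.mono_set (Ioi_subset_Ioi zero_le_one)
  refine not_integrableOn_Ioi_inv (a := (1 : ℝ)) ?_
  refine Integrable.mono' (h1.const_mul ((r0 ^ (-α) + γ) / γ))
    measurable_inv.aestronglyMeasurable ?_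
  filter_upwards [ae_restrict_mem measurableSet_Ioi] with r hr
  have hr1 : 1 < r := hr
  have hr' : 0 < r := one_pos.trans hr
  rw [Real.norm_of_nonneg (by positivity), interferenceIntegrand, ← Real.rpow_neg_one]
  have h2 : r ^ (-1 : ℝ) ≤ r ^ (-α) * r := by
    rw [← Real.rpow_add_one hr'.ne']
    exact Real.rpow_le_rpow_of_exponent_le hr1.le (by linarith)
  have h3 : r ^ (-α) ≤ 1 := Real.rpow_le_one_of_one_le_of_nonpos hr1.le (by linarith)
  have h4 : 0 < r0 ^ (-α) := by positivity
  refine h2.trans ?_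
  rw [← mul_assoc]
  gcongr
  rw [div_mul_div_comm, le_div_iff₀ (by positivity)]
  have h5 : 0 < r ^ (-α) := by positivity
  nlinarith [mul_pos hγ h5, mul_nonneg (mul_pos hγ h5).le (sub_nonneg.2 h3)]

lemma lintegral_interferenceIntegrand_eq_top (hγ : 0 < γ) (hr0 : 0 < r0) (hα0 : 0 < α)
    (hα : α ≤ 2) :
    ∫⁻ r in Ioi 0, ENNReal.ofReal (interferenceIntegrand γ α r0 r) = ∞ := by
  by_contra h
  refine not_integrableOn_interferenceIntegrand hγ hr0 hα0 hα
    ((lintegral_ofReal_ne_top_iff_integrable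
      measurable_interferenceIntegrand.aestronglyMeasurable ?_).1 h)
  filter_upwards [ae_restrict_mem measurableSet_Ioi] with r hr
  exact interferenceIntegrand_nonneg hγ hr0 (le_of_lt hr)

/-- The factor `γ r^(-α) / (r0^(-α) + γ r^(-α))` of the interference integrand: one minus the
Laplace transform of the interference caused by a single transmitter at distance `r`. -/
noncomputable def interferenceRatio (γ α r0 r : ℝ) : ℝ :=
  γ * r ^ (-α) / (r0 ^ (-α) + γ * r ^ (-α))

lemma measurable_interferenceRatio : Measurable (interferenceRatio γ α r0) := by
  unfold interferenceRatio
  fun_prop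

lemma interferenceRatio_nonneg (hγ : 0 < γ) (hr0 : 0 < r0) {r : ℝ} (hr : 0 ≤ r) :
    0 ≤ interferenceRatio γ α r0 r := by
  unfold interferenceRatio
  positivity

lemma integrable_interferenceRatio_norm_iff :
    Integrable (fun x : Plane => interferenceRatio γ α r0 ‖x‖) ↔
      IntegrableOn (interferenceIntegrand γ α r0) (Ioi 0) := by
  rw [integrable_fun_norm_addHaar]
  simp only [finrank_euclideanSpace, Fintype.card_fin, Nat.add_one_sub_one, pow_one, smul_eq_mul]
  simp_rw [interferenceRatio, mul_comm _ (_ / _)]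
  rfl

lemma integral_interferenceRatio_norm :
    ∫ x : Plane, interferenceRatio γ α r0 ‖x‖ =
      2 * Real.pi * ∫ r in Ioi 0, interferenceIntegrand γ α r0 r := by
  rw [integral_fun_norm_addHaar]
  simp only [finrank_euclideanSpace, Fintype.card_fin, Nat.add_one_sub_one, pow_one, smul_eq_mul,
    nsmul_eq_mul]
  simp_rw [interferenceRatio, mul_comm _ (_ / _), Measure.real, EuclideanSpace.volume_ball_fin_two]
  simp [interferenceIntegrand, mul_assoc, Real.pi_nonneg]

lemma lintegral_interferenceRatio_norm (hγ : 0 < γ) (hr0 : 0 < r0) (hα : 2 < α) :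
    ∫⁻ x : Plane, ENNReal.ofReal (interferenceRatio γ α r0 ‖x‖) =
      ENNReal.ofReal (2 * Real.pi * ∫ r in Ioi 0, interferenceIntegrand γ α r0 r) := by
  rw [← integral_interferenceRatio_norm, ofReal_integral_eq_lintegral_ofReal]
  · exact integrable_interferenceRatio_norm_iff.2 (integrableOn_interferenceIntegrand hγ hr0 hα)
  · exact Filter.Eventually.of_forall fun x => interferenceRatio_nonneg hγ hr0 (norm_nonneg x)

lemma lintegral_interferenceRatio_norm_eq_top (hγ : 0 < γ) (hr0 : 0 < r0) (hα0 : 0 < α)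
    (hα : α ≤ 2) : ∫⁻ x : Plane, ENNReal.ofReal (interferenceRatio γ α r0 ‖x‖) = ∞ := by
  by_contra h
  refine not_integrableOn_interferenceIntegrand hγ hr0 hα0 hα
    (integrable_interferenceRatio_norm_iff.1 ((lintegral_ofReal_ne_top_iff_integrable
      (measurable_interferenceRatio.comp measurable_norm).aestronglyMeasurable ?_).1 h))
  exact Filter.Eventually.of_forall fun x => interferenceRatio_nonneg hγ hr0 (norm_nonneg x)

end Interference
-- Grouping the independent sources of randomness
/-- The controller to which a source belongs, together with a flag telling fading coefficients from
access variables; `none` for the locations of the interferers. -/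
def Source.key {T : ℕ} : Source T → Option (ℕ × Bool)
  | .locations => none
  | .ctrl j => some (j, false)
  | .blockCoin j => some (j, false)
  | .slotCoin j _ => some (j, false)
  | .postCoin j _ => some (j, false)
  | .fading j _ => some (j, true)

namespace BlockNetwork

variable {Ω : Type*} {T : ℕ}

/-- The sigma-algebra generated by a set of sources of randomness. -/
@[reducible] noncomputable def sigmaOn (N : BlockNetwork Ω T) (S : Set (Source T)) : MeasurableSpace Ω :=
  ⨆ i ∈ S, N.sigma i

lemma sigma_le_sigmaOn (N : BlockNetwork Ω T) {S : Set (Source T)} {i : Source T} (hi : i ∈ S) :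
    N.sigma i ≤ N.sigmaOn S :=
  le_iSup₂_of_le i hi le_rfl

section Measurability

variable (N : BlockNetwork Ω T) {S : Set (Source T)} {j : ℕ} {t : Fin T}

lemma measurable_ctrl_sigmaOn (h : Source.ctrl j ∈ S) : Measurable[N.sigmaOn S] (N.ctrl j) :=
  (comap_measurable (N.ctrl j)).mono (N.sigma_le_sigmaOn h) le_rfl

lemma measurable_blockCoin_sigmaOn (h : Source.blockCoin j ∈ S) :
    Measurable[N.sigmaOn S] (N.blockCoin j) :=
  (comap_measurable (N.blockCoin j)).mono (N.sigma_le_sigmaOn h) le_rfl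

lemma measurable_slotCoin_sigmaOn (h : Source.slotCoin j t ∈ S) :
    Measurable[N.sigmaOn S] (N.slotCoin j t) :=
  (comap_measurable (N.slotCoin j t)).mono (N.sigma_le_sigmaOn h) le_rfl

lemma measurable_postCoin_sigmaOn (h : Source.postCoin j t ∈ S) :
    Measurable[N.sigmaOn S] (N.postCoin j t) :=
  (comap_measurable (N.postCoin j t)).mono (N.sigma_le_sigmaOn h) le_rfl

lemma measurable_fading_sigmaOn (h : Source.fading j t ∈ S) :
    Measurable[N.sigmaOn S] (N.fading j t) :=
  (comap_measurable (N.fading j t)).mono (N.sigma_le_sigmaOn h) le_rfl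

lemma measurable_pos_sigmaOn (h : Source.locations ∈ S) :
    Measurable[N.sigmaOn S] (N.pos (j + 1)) :=
  (comap_measurable (N.pos (j + 1))).mono
    ((le_iSup (fun j => MeasurableSpace.comap (N.pos (j + 1)) inferInstance) j).trans
      (N.sigma_le_sigmaOn h)) le_rfl

/-- The access variables of controller `j` in slot `t`. -/
def accessVars (j : ℕ) (t : Fin T) (ω : Ω) : Bool × Bool × Bool × Bool :=
  (N.ctrl j ω, N.blockCoin j ω, N.slotCoin j t ω, N.postCoin j t ω)

lemma measurable_accessVars_sigmaOn (h : Source.key ⁻¹' {some (j, false)} ⊆ S) :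
    Measurable[N.sigmaOn S] (N.accessVars j t) :=
  (N.measurable_ctrl_sigmaOn (h rfl)).prodMk ((N.measurable_blockCoin_sigmaOn (h rfl)).prodMk
    ((N.measurable_slotCoin_sigmaOn (h rfl)).prodMk (N.measurable_postCoin_sigmaOn (h rfl))))

lemma measurable_transmits_sigmaOn (h : Source.key ⁻¹' {some (j, false)} ⊆ S) :
    Measurable[N.sigmaOn S] (N.transmits j t) := by
  let F : Bool × Bool × Bool × Bool → Bool := fun q =>
    if q.1 then q.2.2.2 else if q.2.1 then true else q.2.2.1
  have hF : N.transmits j t = F ∘ N.accessVars j t := by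
    funext ω
    simp only [transmits, mode, F, accessVars, Function.comp]
    cases N.ctrl j ω <;> cases N.blockCoin j ω <;> simp
  rw [hF]
  exact Measurable.of_discrete.comp (N.measurable_accessVars_sigmaOn h)

/-- The mode does not depend on the slot; `t` serves only to read the mode off the tuple
`accessVars`. -/
lemma measurableSet_mode_sigmaOn (t : Fin T) (h : Source.key ⁻¹' {some (j, false)} ⊆ S)
    (φ : AccessMode) : MeasurableSet[N.sigmaOn S] {ω | N.mode j ω = φ} := by
  let F : Bool × Bool × Bool × Bool → AccessMode := fun q =>
    if q.1 then .post else if q.2.1 then .block else .slot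
  have hF : {ω | N.mode j ω = φ} = N.accessVars j t ⁻¹' {q | F q = φ} := rfl
  rw [hF]
  exact N.measurable_accessVars_sigmaOn h (MeasurableSet.of_discrete)

/-- The received power of controller `j` in slot `t`, without path loss. -/
noncomputable def mark (ξ : ℝ) (j : ℕ) (t : Fin T) (ω : Ω) : ℝ≥0∞ :=
  ENNReal.ofReal ((if N.transmits j t ω = true then 1 else 0) * ξ * ‖N.fading j t ω‖ ^ 2)

lemma measurable_mark_sigmaOn (ξ : ℝ)
    (h : Source.key ⁻¹' {some (j, false), some (j, true)} ⊆ S) :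
    Measurable[N.sigmaOn S] (N.mark ξ j t) := by
  let F : Bool × ℂ → ℝ≥0∞ := fun q =>
    ENNReal.ofReal ((if q.1 = true then 1 else 0) * ξ * ‖q.2‖ ^ 2)
  have hF : Measurable F := by
    refine ENNReal.measurable_ofReal.comp (((Measurable.ite ?_ ?_ ?_).mul_const _).mul (by fun_prop))
    · exact measurable_fst (measurableSet_singleton true)
    · exact measurable_const
    · exact measurable_const
  exact hF.comp ((N.measurable_transmits_sigmaOn ((preimage_mono (by simp)).trans h)).prodMk
    (N.measurable_fading_sigmaOn (h (by simp [Source.key]))))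

/-- The total interference power in slot `t`. -/
noncomputable def interference (ξ α : ℝ) (t : Fin T) (ω : Ω) : ℝ≥0∞ :=
  ∑' j : ℕ, ENNReal.ofReal (N.receivedPower ξ α (j + 1) t ω)

/-- Separates the random mark from the location, the form required by the marked Laplace functional.
-/
lemma ofReal_receivedPower (ξ α : ℝ) (j : ℕ) (t : Fin T) (ω : Ω) :
    ENNReal.ofReal (N.receivedPower ξ α j t ω) =
      N.mark ξ j t ω * ENNReal.ofReal (‖N.pos j ω‖ ^ (-α)) :=
  ENNReal.ofReal_mul' (by positivity)

lemma measurable_interference_sigmaOn (ξ α : ℝ)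
    (h : Source.key ⁻¹' {k | k ≠ some (0, false) ∧ k ≠ some (0, true)} ⊆ S) :
    Measurable[N.sigmaOn S] (N.interference ξ α t) := by
  have hF : Measurable fun q : ℝ≥0∞ × Plane => q.1 * ENNReal.ofReal (‖q.2‖ ^ (-α)) := by fun_prop
  have h' (j : ℕ) : Measurable[N.sigmaOn S]
      fun ω => ENNReal.ofReal (N.receivedPower ξ α (j + 1) t ω) := by
    simp_rw [ofReal_receivedPower]
    refine hF.comp ((N.measurable_mark_sigmaOn ξ ((preimage_mono ?_).trans h)).prodMk
      (N.measurable_pos_sigmaOn (h (by simp [Source.key]))))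
    rintro k (rfl | rfl) <;> simp
  have hm : Measurable fun x : ℕ → ℝ≥0∞ => ∑' j, x j := Measurable.tsum measurable_pi_apply
  exact hm.comp (@measurable_pi_lambda _ _ _ (N.sigmaOn S) _ _ h')

end Measurability

/-! ### Independence of groups of sources and the transmission probability -/

namespace IsModel

variable [MeasurableSpace Ω] {N : BlockNetwork Ω T} {μ : Measure Ω} {r0 lam δB δS δC : ℝ}

lemma sigma_le (hN : N.IsModel μ r0 lam δB δS δC) (i : Source T) : N.sigma i ≤ ‹_› := by
  cases i with
  | locations => exact iSup_le fun j => (hN.poisson.measurable j).comap_le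
  | ctrl j => exact (hN.measurable_ctrl j).comap_le
  | blockCoin j => exact (hN.measurable_blockCoin j).comap_le
  | slotCoin j t => exact (hN.measurable_slotCoin j t).comap_le
  | postCoin j t => exact (hN.measurable_postCoin j t).comap_le
  | fading j t => exact (hN.measurable_fading j t).comap_le

lemma sigmaOn_le (hN : N.IsModel μ r0 lam δB δS δC) (S : Set (Source T)) : N.sigmaOn S ≤ ‹_› :=
  iSup₂_le fun i _ => hN.sigma_le i

/-- All later independence claims come from here, mostly for preimages under `Source.key`, where
disjointness is checked on the keys. -/
lemma indep_sigmaOn (hN : N.IsModel μ r0 lam δB δS δC) {S S' : Set (Source T)}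
    (h : Disjoint S S') : Indep (N.sigmaOn S) (N.sigmaOn S') μ :=
  indep_iSup_of_disjoint hN.sigma_le hN.indep h

lemma real_inter (hN : N.IsModel μ r0 lam δB δS δC) {S S' : Set (Source T)}
    (h : Disjoint S S') {A B : Set Ω} (hA : MeasurableSet[N.sigmaOn S] A)
    (hB : MeasurableSet[N.sigmaOn S'] B) : μ.real (A ∩ B) = μ.real A * μ.real B := by
  rw [Measure.real, (Indep_iff _ _ μ).1 (hN.indep_sigmaOn h) A B hA hB, ENNReal.toReal_mul]
  rfl

variable [IsProbabilityMeasure μ]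

lemma real_transmits (hN : N.IsModel μ r0 lam δB δS δC) (j : ℕ) (t : Fin T) :
    μ.real {ω | N.transmits j t ω = true} = N.stateProb μ * δC +
      (1 - N.stateProb μ) * δB + (1 - N.stateProb μ) * ((1 - δB) * δS) := by
  obtain ⟨C, hC⟩ : ∃ C, C = {ω | N.ctrl j ω = true} := ⟨_, rfl⟩
  obtain ⟨B, hB⟩ : ∃ B, B = {ω | N.blockCoin j ω = true} := ⟨_, rfl⟩
  obtain ⟨D, hD⟩ : ∃ D, D = {ω | N.slotCoin j t ω = true} := ⟨_, rfl⟩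
  obtain ⟨E, hE⟩ : ∃ E, E = {ω | N.postCoin j t ω = true} := ⟨_, rfl⟩
  have hc (S : Set (Source T)) (h : Source.ctrl j ∈ S) : MeasurableSet[N.sigmaOn S] C :=
    hC ▸ N.measurable_ctrl_sigmaOn h (measurableSet_singleton true)
  have hb (S : Set (Source T)) (h : Source.blockCoin j ∈ S) : MeasurableSet[N.sigmaOn S] B :=
    hB ▸ N.measurable_blockCoin_sigmaOn h (measurableSet_singleton true)
  have hs (S : Set (Source T)) (h : Source.slotCoin j t ∈ S) : MeasurableSet[N.sigmaOn S] D :=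
    hD ▸ N.measurable_slotCoin_sigmaOn h (measurableSet_singleton true)
  have hp (S : Set (Source T)) (h : Source.postCoin j t ∈ S) : MeasurableSet[N.sigmaOn S] E :=
    hE ▸ N.measurable_postCoin_sigmaOn h (measurableSet_singleton true)
  have hc' (S : Set (Source T)) (h : Source.ctrl j ∈ S) : MeasurableSet[N.sigmaOn S] Cᶜ :=
    @MeasurableSet.compl _ _ (N.sigmaOn S) (hc S h)
  have hb' (S : Set (Source T)) (h : Source.blockCoin j ∈ S) : MeasurableSet[N.sigmaOn S] Bᶜ :=
    @MeasurableSet.compl _ _ (N.sigmaOn S) (hb S h)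
  have hCm : MeasurableSet C := hN.sigmaOn_le _ _ (hc univ (mem_univ _))
  have hBm : MeasurableSet B := hN.sigmaOn_le _ _ (hb univ (mem_univ _))
  have hDm : MeasurableSet D := hN.sigmaOn_le _ _ (hs univ (mem_univ _))
  -- Disjoint cases: mode `post` with a won lottery, mode `block`, mode `slot` with a won lottery.
  have hsplit : {ω | N.transmits j t ω = true} = (C ∩ E ∪ Cᶜ ∩ B) ∪ Cᶜ ∩ (Bᶜ ∩ D) := by
    ext ω
    simp only [transmits, mode, hC, hB, hD, hE, mem_ofPred_eq, mem_union, mem_inter_iff,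
      mem_compl_iff]
    cases N.ctrl j ω <;> cases N.blockCoin j ω <;> simp
  have h1 : μ.real (C ∩ E) = μ.real C * μ.real E :=
    hN.real_inter (S := {.ctrl j}) (S' := {.postCoin j t}) (by simp)
      (hc _ (mem_singleton _)) (hp _ (mem_singleton _))
  have h2 : μ.real (Cᶜ ∩ B) = μ.real Cᶜ * μ.real B :=
    hN.real_inter (S := {.ctrl j}) (S' := {.blockCoin j}) (by simp)
      (hc' _ (mem_singleton _)) (hb _ (mem_singleton _))
  have h3 : μ.real (Bᶜ ∩ D) = μ.real Bᶜ * μ.real D :=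
    hN.real_inter (S := {.blockCoin j}) (S' := {.slotCoin j t}) (by simp)
      (hb' _ (mem_singleton _)) (hs _ (mem_singleton _))
  have h4 : μ.real (Cᶜ ∩ (Bᶜ ∩ D)) = μ.real Cᶜ * μ.real (Bᶜ ∩ D) :=
    hN.real_inter (S := {.ctrl j}) (S' := {.blockCoin j, .slotCoin j t}) (by simp)
      (hc' _ (mem_singleton _))
      (MeasurableSet.inter (hb' _ (by simp)) (hs _ (by simp)))
  rw [hsplit, measureReal_union _ (hCm.compl.inter (hBm.compl.inter hDm)),
    measureReal_union _ (hCm.compl.inter hBm), h1, h2, h4, h3, probReal_compl_eq_one_sub hCm,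
    probReal_compl_eq_one_sub hBm, hC, hB, hD, hE, hN.ctrl_prob, hN.blockCoin_prob,
    hN.slotCoin_prob, hN.postCoin_prob]
  · exact disjoint_left.2 fun ω h h' => h'.1 h.1
  · refine disjoint_left.2 fun ω h h' => ?_
    rcases h with h | h
    · exact h'.1 h.1
    · exact h'.2.1 h.2

lemma lambdaEff_eq (hN : N.IsModel μ r0 lam δB δS δC) (j : ℕ) (t : Fin T) :
    N.lambdaEff μ lam δB δS δC = lam * μ.real {ω | N.transmits j t ω = true} := by
  rw [hN.real_transmits, lambdaEff, lambdaB, lambdaS, lambdaC]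
  ring

lemma real_transmits_eq (hN : N.IsModel μ r0 lam δB δS δC) (i j : ℕ) (t : Fin T) :
    μ.real {ω | N.transmits i t ω = true} = μ.real {ω | N.transmits j t ω = true} := by
  rw [hN.real_transmits, hN.real_transmits]

end IsModel

/-! ### The Laplace transform of the interference -/

/-- The Laplace transform of the marks, when `p` is the transmission probability. -/
noncomputable def markLaplace (p ξ : ℝ) (c : ℝ≥0∞) : ℝ≥0∞ :=
  1 - ENNReal.ofReal (p * (ξ * c.toReal / (1 + ξ * c.toReal)))

lemma measurable_markLaplace (p ξ : ℝ) : Measurable (markLaplace p ξ) := by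
  unfold markLaplace
  fun_prop

namespace IsModel

variable [MeasurableSpace Ω] {N : BlockNetwork Ω T} {μ : Measure Ω} {r0 lam δB δS δC : ℝ}
  [IsProbabilityMeasure μ]

/-- A silent controller contributes the factor 1, with probability `1 - p`. A transmitting one
contributes the Laplace transform `1 / (1 + s)` of an exponential variable, because the fading is
independent of the access variables. The sum is `1 - p s / (1 + s)`. -/
lemma lintegral_expNeg_mark (hN : N.IsModel μ r0 lam δB δS δC) {ξ : ℝ} (hξ : 0 < ξ) (j : ℕ)
    (t : Fin T) {c : ℝ≥0∞} (hc : c ≠ ∞) :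
    ∫⁻ ω, expNeg (N.mark ξ j t ω * c) ∂μ =
      markLaplace (μ.real {ω | N.transmits j t ω = true}) ξ c := by
  set A := {ω | N.transmits j t ω = true} with hA
  set s := ξ * c.toReal with hs
  have hs0 : 0 ≤ s := by positivity
  have hAm' : MeasurableSet[N.sigmaOn (Source.key ⁻¹' {some (j, false)})] A :=
    N.measurable_transmits_sigmaOn subset_rfl (measurableSet_singleton true)
  have hAm : MeasurableSet A := hN.sigmaOn_le _ _ hAm'
  have hAi : Measurable[N.sigmaOn (Source.key ⁻¹' {some (j, false)})]
      (A.indicator (1 : Ω → ℝ≥0∞)) :=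
    Measurable.indicator (f := 1) measurable_const hAm'
  let f : ℝ → ℝ≥0∞ := fun x => expNeg (ENNReal.ofReal (s * x ^ 2))
  have hf : Measurable f := by fun_prop
  have hhm : Measurable[N.sigmaOn (Source.key ⁻¹' {some (j, true)})]
      fun ω => f ‖N.fading j t ω‖ :=
    (hf.comp measurable_norm).comp (N.measurable_fading_sigmaOn rfl)
  have hpt (ω : Ω) : expNeg (N.mark ξ j t ω * c) =
      A.indicator 1 ω * f ‖N.fading j t ω‖ + Aᶜ.indicator 1 ω := by
    by_cases h : N.transmits j t ω = true
    · have h1 : ω ∈ A := h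
      rw [mark, if_pos h, ← ENNReal.ofReal_toReal hc, ← ENNReal.ofReal_mul (by positivity)]
      simp only [h1, indicator_of_mem, Pi.one_apply, one_mul, mem_compl_iff, not_true_eq_false,
        not_false_eq_true, indicator_of_notMem, add_zero, f, hs]
      ring_nf
    · have h1 : ω ∉ A := h
      rw [mark, if_neg h]
      simp [h1]
  have hlap : ∫⁻ ω, f ‖N.fading j t ω‖ ∂μ = ENNReal.ofReal (1 / (1 + s)) := by
    rw [← lintegral_expNeg_rayleighMeasure_one hs0, ← (hN.fading_law j t).map_eq,
      lintegral_map' hf.aemeasurable (hN.fading_law j t).aemeasurable]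
  have hint : ∫⁻ ω, A.indicator 1 ω * f ‖N.fading j t ω‖ ∂μ =
      (∫⁻ ω, A.indicator 1 ω ∂μ) * ∫⁻ ω, f ‖N.fading j t ω‖ ∂μ :=
    lintegral_mul_eq_lintegral_mul_lintegral_of_independent_measurableSpace
      (hN.sigmaOn_le _) (hN.sigmaOn_le _)
      (hN.indep_sigmaOn (S := Source.key ⁻¹' {some (j, false)})
        (S' := Source.key ⁻¹' {some (j, true)}) (Disjoint.preimage _ (by simp)))
      hAi hhm
  simp_rw [hpt]
  rw [lintegral_add_right _ (measurable_one.indicator hAm.compl), hint, hlap,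
    lintegral_indicator_one hAm, lintegral_indicator_one hAm.compl,
    ← ofReal_measureReal (s := A), ← ofReal_measureReal (s := Aᶜ), probReal_compl_eq_one_sub hAm,
    markLaplace, ← hs, ← ENNReal.ofReal_mul measureReal_nonneg, ← ENNReal.ofReal_add (by positivity)
      (sub_nonneg.2 measureReal_le_one), ← ENNReal.ofReal_one,
      ← ENNReal.ofReal_sub _ (by positivity)]
  congr 1
  field_simp
  ring

/-- Different controllers own different keys, so their marks are independent and the factors split
off one by one. All controllers have the same transmission probability, hence the index 0 on the
right. -/
lemma lintegral_prod_expNeg_mark (hN : N.IsModel μ r0 lam δB δS δC) {ξ : ℝ} (hξ : 0 < ξ)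
    (t : Fin T) (n : ℕ) (c : ℕ → ℝ≥0∞) (hc : ∀ j, c j ≠ ∞) :
    ∫⁻ ω, ∏ j ∈ Finset.range n, expNeg (N.mark ξ (j + 1) t ω * c j) ∂μ =
      ∏ j ∈ Finset.range n, markLaplace (μ.real {ω | N.transmits 0 t ω = true}) ξ (c j) := by
  induction n with
  | zero => simp
  | succ n ih =>
    simp_rw [Finset.prod_range_succ]
    let S : Set (Option (ℕ × Bool)) := {k | ∃ j < n, ∃ b, k = some (j + 1, b)}
    have hm (j : ℕ) {S : Set (Option (ℕ × Bool))} (hS : ∀ b, some (j + 1, b) ∈ S) :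
        Measurable[N.sigmaOn (Source.key ⁻¹' S)]
          fun ω => expNeg (N.mark ξ (j + 1) t ω * c j) := by
      have hm' : Measurable fun x => expNeg (x * c j) := by fun_prop
      refine hm'.comp (N.measurable_mark_sigmaOn ξ (preimage_mono ?_))
      rintro k (rfl | rfl) <;> exact hS _
    have hS : Disjoint S {k | ∃ b, k = some (n + 1, b)} := by
      refine disjoint_left.2 ?_
      rintro _ ⟨j, hj, b, rfl⟩ ⟨b', h⟩
      simp at h
      omega
    rw [lintegral_mul_eq_lintegral_mul_lintegral_of_independent_measurableSpace
      (hN.sigmaOn_le _) (hN.sigmaOn_le _) (hN.indep_sigmaOn (Disjoint.preimage Source.key hS))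
      (Finset.measurable_fun_prod _ fun j hj => hm j fun b => ⟨j, Finset.mem_range.1 hj, b, rfl⟩)
      (hm n fun b => ⟨b, rfl⟩), ih, hN.lintegral_expNeg_mark hξ _ _ (hc n),
      hN.real_transmits_eq (n + 1) 0]

lemma lintegral_expNeg_interference (hN : N.IsModel μ r0 lam δB δS δC) {ξ α γ : ℝ}
    (hξ : 0 < ξ) (hγ : 0 < γ) (hr0 : 0 < r0) (hlam : 0 < lam) (t : Fin T) :
    ∫⁻ ω, expNeg (ENNReal.ofReal (γ / (ξ * r0 ^ (-α))) * N.interference ξ α t ω) ∂μ =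
      expNeg (ENNReal.ofReal (N.lambdaEff μ lam δB δS δC) *
        ∫⁻ x : Plane, ENNReal.ofReal (interferenceRatio γ α r0 ‖x‖)) := by
  set p := μ.real {ω | N.transmits 0 t ω = true} with hp
  set κ := γ / (ξ * r0 ^ (-α)) with hκ
  have hl0 : 0 < r0 ^ (-α) := by positivity
  let g : Plane → ℝ≥0∞ := fun x => ENNReal.ofReal (κ * ‖x‖ ^ (-α))
  have hg : Measurable g := by fun_prop
  have hI (ω : Ω) : ENNReal.ofReal κ * N.interference ξ α t ω =
      ∑' j, N.mark ξ (j + 1) t ω * g (N.pos (j + 1) ω) := by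
    rw [interference, ← ENNReal.tsum_mul_left]
    refine tsum_congr fun j => ?_
    simp only [g]
    rw [ofReal_receivedPower, ENNReal.ofReal_mul (by positivity)]
    ring
  -- The locations are the only source with key `none`; the marks use only the other keys.
  have hind : IndepFun (fun ω (j : ℕ) => N.pos (j + 1) ω) (fun ω j => N.mark ξ (j + 1) t ω) μ := by
    have h := hN.indep_sigmaOn (S := Source.key ⁻¹' {none}) (S' := Source.key ⁻¹' {none}ᶜ)
      (Disjoint.preimage _ disjoint_compl_right)
    refine indep_of_indep_of_le_left (indep_of_indep_of_le_right h ?_) ?_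
    · refine Measurable.comap_le (@measurable_pi_lambda _ _ _ (N.sigmaOn _) _ _ fun j =>
        N.measurable_mark_sigmaOn ξ (preimage_mono ?_))
      rintro k (rfl | rfl) <;> simp
    · exact Measurable.comap_le (@measurable_pi_lambda _ _ _ (N.sigmaOn _) _ _ fun j => N.measurable_pos_sigmaOn rfl)
  simp_rw [hI]
  rw [hN.poisson.lintegral_expNeg_tsum_mul hlam.le (M := fun j => N.mark ξ (j + 1) t)
    (fun j => (N.measurable_mark_sigmaOn ξ subset_rfl).mono (hN.sigmaOn_le _) le_rfl) hind
    (measurable_markLaplace p ξ) (fun c => tsub_le_self)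
    (hN.lintegral_prod_expNeg_mark hξ t) hg (fun x => ENNReal.ofReal_ne_top)]
  -- The path loss enters both sides through the same nonnegative number `‖x‖^(-α)`, so the origin
  -- needs no exception.
  have hu (x : Plane) : 1 - markLaplace p ξ (g x) =
      ENNReal.ofReal p * ENNReal.ofReal (interferenceRatio γ α r0 ‖x‖) := by
    have hs : ξ * (g x).toReal / (1 + ξ * (g x).toReal) = interferenceRatio γ α r0 ‖x‖ := by
      simp only [g]
      rw [ENNReal.toReal_ofReal (by positivity), interferenceRatio, hκ]
      field_simp
    have hr : interferenceRatio γ α r0 ‖x‖ ≤ 1 := by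
      rw [interferenceRatio, div_le_one (by positivity)]
      linarith
    rw [markLaplace, hs, ENNReal.sub_sub_cancel ENNReal.one_ne_top,
      ENNReal.ofReal_mul measureReal_nonneg]
    rw [ENNReal.ofReal_le_one]
    exact mul_le_one₀ measureReal_le_one (interferenceRatio_nonneg hγ hr0 (norm_nonneg x)) hr
  simp_rw [hu]
  rw [lintegral_const_mul' _ _ ENNReal.ofReal_ne_top, ← mul_assoc, ← ENNReal.ofReal_mul hlam.le,
    ← hN.lambdaEff_eq]

/-! ### The success probability of the typical controller -/

/-- The probability that the typical controller succeeds on an event that forces it to transmit and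
is determined by its own access variables. -/
lemma measure_inter_success (hN : N.IsModel μ r0 lam δB δS δC) {ξ No α γ : ℝ}
    (hξ : 0 < ξ) (hNo : 0 ≤ No) (hγ : 0 < γ) (hr0 : 0 < r0) (hlam : 0 < lam) (t : Fin T)
    {A : Set Ω} (hA : MeasurableSet[N.sigmaOn (Source.key ⁻¹' {some (0, false)})] A)
    (hAt : ∀ ω ∈ A, N.transmits 0 t ω = true) :
    μ (A ∩ {ω | ENNReal.ofReal γ < N.sinr ξ No α t ω}) =
      μ A * (ENNReal.ofReal (Real.exp (-(γ * No / (ξ * r0 ^ (-α))))) *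
        expNeg (ENNReal.ofReal (N.lambdaEff μ lam δB δS δC) *
          ∫⁻ x : Plane, ENNReal.ofReal (interferenceRatio γ α r0 ‖x‖))) := by
  have hK : 0 < ξ * r0 ^ (-α) := by positivity
  set K := ξ * r0 ^ (-α) with hKdef
  let Y : Ω → ℝ≥0∞ := fun ω => ENNReal.ofReal γ * (ENNReal.ofReal No + N.interference ξ α t ω)
  let H : Ω → ℝ := fun ω => ‖N.fading 0 t ω‖
  let R : Set (ℝ≥0∞ × ℝ) := {q | q.1 < ENNReal.ofReal (K * q.2 ^ 2)}
  have hR : MeasurableSet R := measurableSet_lt measurable_fst (by fun_prop)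
  have hset : A ∩ {ω | ENNReal.ofReal γ < N.sinr ξ No α t ω} =
      A ∩ (fun ω => (Y ω, H ω)) ⁻¹' R := by
    ext ω
    refine and_congr_right fun hω => ?_
    have hpow : N.receivedPower ξ α 0 t ω = K * ‖N.fading 0 t ω‖ ^ 2 := by
      rw [receivedPower, if_pos (hAt ω hω), hN.pos_zero, hKdef]
      ring
    change ENNReal.ofReal γ < N.sinr ξ No α t ω ↔ Y ω < ENNReal.ofReal (K * H ω ^ 2)
    -- The denominator may be 0 or `∞`; clearing it is legitimate because `γ` is neither.
    rw [sinr, ENNReal.lt_div_iff_mul_lt (Or.inr ENNReal.ofReal_ne_top)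
      (Or.inr (by simpa using hγ)), hpow]
    rfl
  have hYm {S : Set (Source T)}
      (h : Source.key ⁻¹' {k | k ≠ some (0, false) ∧ k ≠ some (0, true)} ⊆ S) :
      Measurable[N.sigmaOn S] Y := by
    have hm : Measurable fun x => ENNReal.ofReal γ * (ENNReal.ofReal No + x) := by fun_prop
    exact hm.comp (N.measurable_interference_sigmaOn ξ α h)
  have hHm {S : Set (Source T)} (h : Source.fading 0 t ∈ S) : Measurable[N.sigmaOn S] H :=
    measurable_norm.comp (N.measurable_fading_sigmaOn h)
  have hYm' : Measurable Y := (hYm subset_rfl).mono (hN.sigmaOn_le _) le_rfl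
  have hHm' : Measurable H := (hHm (mem_univ _)).mono (hN.sigmaOn_le _) le_rfl
  -- `A` uses only the access variables of controller 0, whereas `Y` and `H` use none of them.
  have hAR : μ (A ∩ (fun ω => (Y ω, H ω)) ⁻¹' R) = μ A * μ ((fun ω => (Y ω, H ω)) ⁻¹' R) := by
    refine (Indep_iff _ _ μ).1 (hN.indep_sigmaOn (S' := Source.key ⁻¹' {some (0, false)}ᶜ)
      (Disjoint.preimage _ disjoint_compl_right)) _ _ hA ?_
    have hf : Source.fading 0 t ∈ Source.key ⁻¹' {some (0, false)}ᶜ := by simp [Source.key]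
    exact ((hYm (preimage_mono fun k hk => hk.1)).prodMk (hHm hf)) hR
  have hYH : IndepFun Y H μ := by
    have h := hN.indep_sigmaOn
      (S := Source.key ⁻¹' {k | k ≠ some (0, false) ∧ k ≠ some (0, true)})
      (S' := Source.key ⁻¹' {some (0, true)})
      (Disjoint.preimage _ (disjoint_singleton_right.2 fun h => h.2 rfl))
    have hf : Source.fading 0 t ∈ Source.key ⁻¹' {some (0, true)} := rfl
    exact indep_of_indep_of_le_left (indep_of_indep_of_le_right h (hHm hf).comap_le)
      (hYm subset_rfl).comap_le
  -- By Fubini, integrate `H` first: for fixed `Y = y` the probability is the exponential tail.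
  have hYR : μ ((fun ω => (Y ω, H ω)) ⁻¹' R) = ∫⁻ ω, expNeg (Y ω * ENNReal.ofReal K⁻¹) ∂μ := by
    have := Measure.isProbabilityMeasure_map (μ := μ) hHm'.aemeasurable
    have hm : Measurable fun y => expNeg (y * ENNReal.ofReal K⁻¹) := by fun_prop
    rw [← Measure.map_apply (hYm'.prodMk hHm') hR,
      hYH.map_prod_eq_prod_map_map hYm'.aemeasurable hHm'.aemeasurable, Measure.prod_apply hR,
      ← lintegral_map hm hYm']
    refine lintegral_congr fun y => ?_
    rw [(hN.fading_law 0 t).map_eq, ← rayleighMeasure_one_tail hK]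
    rfl
  have hsplit (ω : Ω) : expNeg (Y ω * ENNReal.ofReal K⁻¹) =
      ENNReal.ofReal (Real.exp (-(γ * No / K))) *
        expNeg (ENNReal.ofReal (γ / K) * N.interference ξ α t ω) := by
    rw [← expNeg_ofReal (by positivity), ← expNeg_add, div_eq_mul_inv, div_eq_mul_inv,
      ENNReal.ofReal_mul (by positivity), ENNReal.ofReal_mul hγ.le, ENNReal.ofReal_mul hγ.le]
    congr 1
    simp only [Y]
    ring
  rw [hset, hAR, hYR]
  simp_rw [hsplit]
  rw [lintegral_const_mul' _ _ ENNReal.ofReal_ne_top,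
    hN.lintegral_expNeg_interference hξ hγ hr0 hlam]

lemma cond_success (hN : N.IsModel μ r0 lam δB δS δC) {ξ No α γ : ℝ}
    (hξ : 0 < ξ) (hNo : 0 ≤ No) (hγ : 0 < γ) (hr0 : 0 < r0) (hlam : 0 < lam) (t : Fin T)
    {A : Set Ω} (hA : MeasurableSet[N.sigmaOn (Source.key ⁻¹' {some (0, false)})] A)
    (hAt : ∀ ω ∈ A, N.transmits 0 t ω = true) (hA0 : μ A ≠ 0) :
    (μ[|A]).real {ω | ENNReal.ofReal γ < N.sinr ξ No α t ω} =
      Real.exp (-(γ * No / (ξ * r0 ^ (-α)))) *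
        (expNeg (ENNReal.ofReal (N.lambdaEff μ lam δB δS δC) *
          ∫⁻ x : Plane, ENNReal.ofReal (interferenceRatio γ α r0 ‖x‖))).toReal := by
  rw [Measure.real, cond_apply (hN.sigmaOn_le _ _ hA),
    hN.measure_inter_success hξ hNo hγ hr0 hlam t hA hAt, ← mul_assoc,
    ENNReal.inv_mul_cancel hA0 (measure_ne_top _ _), one_mul, ENNReal.toReal_mul,
    ENNReal.toReal_ofReal (Real.exp_nonneg _)]

/-- The conditioning event has positive probability and forces transmission, so `p > 0`. -/
lemma lambdaEff_pos (hN : N.IsModel μ r0 lam δB δS δC) (hlam : 0 < lam) (t : Fin T) {A : Set Ω}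
    (hAt : ∀ ω ∈ A, N.transmits 0 t ω = true) (hA0 : μ A ≠ 0) :
    0 < N.lambdaEff μ lam δB δS δC := by
  rw [hN.lambdaEff_eq 0 t]
  refine mul_pos hlam (ENNReal.toReal_pos (fun h => hA0 (measure_mono_null hAt h))
    (measure_ne_top _ _))

lemma cond_success_of_two_lt (hN : N.IsModel μ r0 lam δB δS δC) {ξ No α γ : ℝ}
    (hξ : 0 < ξ) (hNo : 0 ≤ No) (hγ : 0 < γ) (hr0 : 0 < r0) (hlam : 0 < lam) (hα : 2 < α)
    (t : Fin T) {A : Set Ω}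
    (hA : MeasurableSet[N.sigmaOn (Source.key ⁻¹' {some (0, false)})] A)
    (hAt : ∀ ω ∈ A, N.transmits 0 t ω = true) (hA0 : μ A ≠ 0) :
    (μ[|A]).real {ω | ENNReal.ofReal γ < N.sinr ξ No α t ω} =
      Real.exp (-(γ * No / (ξ * r0 ^ (-α)))) *
        Real.exp (-(2 * Real.pi * N.lambdaEff μ lam δB δS δC *
          ∫ r in Ioi 0, interferenceIntegrand γ α r0 r)) := by
  have hl := hN.lambdaEff_pos hlam t hAt hA0
  have hi : 0 ≤ ∫ r in Ioi 0, interferenceIntegrand γ α r0 r :=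
    setIntegral_nonneg measurableSet_Ioi fun r hr =>
      interferenceIntegrand_nonneg hγ hr0 (le_of_lt hr)
  rw [hN.cond_success hξ hNo hγ hr0 hlam t hA hAt hA0,
    lintegral_interferenceRatio_norm hγ hr0 hα, ← ENNReal.ofReal_mul hl.le,
    expNeg_ofReal (by positivity), ENNReal.toReal_ofReal (Real.exp_nonneg _)]
  ring_nf

lemma cond_success_of_le_two (hN : N.IsModel μ r0 lam δB δS δC) {ξ No α γ : ℝ}
    (hξ : 0 < ξ) (hNo : 0 ≤ No) (hγ : 0 < γ) (hr0 : 0 < r0) (hlam : 0 < lam) (hα0 : 0 < α)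
    (hα : α ≤ 2) (t : Fin T) {A : Set Ω}
    (hA : MeasurableSet[N.sigmaOn (Source.key ⁻¹' {some (0, false)})] A)
    (hAt : ∀ ω ∈ A, N.transmits 0 t ω = true) (hA0 : μ A ≠ 0) :
    (μ[|A]).real {ω | ENNReal.ofReal γ < N.sinr ξ No α t ω} = 0 := by
  have hl := hN.lambdaEff_pos hlam t hAt hA0
  -- Positivity of `lambdaEff` is essential here: `0 * ∞ = 0` would make the interference factor 1
  -- instead of 0.
  rw [hN.cond_success hξ hNo hγ hr0 hlam t hA hAt hA0,
    lintegral_interferenceRatio_norm_eq_top hγ hr0 hα0 hα, ENNReal.mul_top (by simpa using hl)]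
  simp

end IsModel
end BlockNetwork
end WirelessControl
-- Conditioning on a mode, or on transmission alone
theorem mainTheorem3 {Ω : Type*} [MeasurableSpace Ω] (μ : Measure Ω) [IsProbabilityMeasure μ]
    (T : ℕ) (γ ξ No α r0 lam δB δS δC : ℝ)
    (hγ : 0 < γ) (hξ : 0 < ξ) (hNo : 0 ≤ No) (hα : 0 < α) (hr0 : 0 < r0) (hlam : 0 < lam)
    (N : WirelessControl.BlockNetwork Ω T) (hN : N.IsModel μ r0 lam δB δS δC) (t : Fin T) :
    (2 < α →
      IntegrableOn (WirelessControl.interferenceIntegrand γ α r0) (Ioi 0) ∧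
      (∀ φ : WirelessControl.AccessMode,
        μ {ω | N.transmits 0 t ω = true ∧ N.mode 0 ω = φ} ≠ 0 →
        (μ[|{ω | N.transmits 0 t ω = true ∧ N.mode 0 ω = φ}]).real
            {ω | ENNReal.ofReal γ < N.sinr ξ No α t ω} =
          Real.exp (-(γ * No / (ξ * r0 ^ (-α)))) *
            Real.exp (-(2 * Real.pi * N.lambdaEff μ lam δB δS δC *
              ∫ r in Ioi 0, WirelessControl.interferenceIntegrand γ α r0 r))) ∧
      (μ {ω | N.transmits 0 t ω = true} ≠ 0 →
        (μ[|{ω | N.transmits 0 t ω = true}]).real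
            {ω | ENNReal.ofReal γ < N.sinr ξ No α t ω} =
          Real.exp (-(γ * No / (ξ * r0 ^ (-α)))) *
            Real.exp (-(2 * Real.pi * N.lambdaEff μ lam δB δS δC *
              ∫ r in Ioi 0, WirelessControl.interferenceIntegrand γ α r0 r)))) ∧
    (α ≤ 2 →
      ∫⁻ r in Ioi 0, ENNReal.ofReal (WirelessControl.interferenceIntegrand γ α r0 r) = ∞ ∧
      (∀ φ : WirelessControl.AccessMode,
        μ {ω | N.transmits 0 t ω = true ∧ N.mode 0 ω = φ} ≠ 0 →
        (μ[|{ω | N.transmits 0 t ω = true ∧ N.mode 0 ω = φ}]).real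
            {ω | ENNReal.ofReal γ < N.sinr ξ No α t ω} = 0) ∧
      (μ {ω | N.transmits 0 t ω = true} ≠ 0 →
        (μ[|{ω | N.transmits 0 t ω = true}]).real
            {ω | ENNReal.ofReal γ < N.sinr ξ No α t ω} = 0)) := by
  have htr : MeasurableSet[N.sigmaOn (WirelessControl.Source.key ⁻¹' {some (0, false)})]
      {ω | N.transmits 0 t ω = true} :=
    N.measurable_transmits_sigmaOn subset_rfl (measurableSet_singleton true)
  have hmode (φ : WirelessControl.AccessMode) :
      MeasurableSet[N.sigmaOn (WirelessControl.Source.key ⁻¹' {some (0, false)})]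
        {ω | N.transmits 0 t ω = true ∧ N.mode 0 ω = φ} :=
    htr.inter (N.measurableSet_mode_sigmaOn t subset_rfl φ)
  refine ⟨fun hα' => ⟨WirelessControl.integrableOn_interferenceIntegrand hγ hr0 hα', fun φ h => ?_,
    fun h => ?_⟩, fun hα' =>
    ⟨WirelessControl.lintegral_interferenceIntegrand_eq_top hγ hr0 hα hα', fun φ h => ?_,
      fun h => ?_⟩⟩
  · exact hN.cond_success_of_two_lt hξ hNo hγ hr0 hlam hα' t (hmode φ) (fun ω h => h.1) h
  · exact hN.cond_success_of_two_lt hξ hNo hγ hr0 hlam hα' t htr (fun ω h => h) h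
  · exact hN.cond_success_of_le_two hξ hNo hγ hr0 hlam hα hα' t (hmode φ) (fun ω h => h.1) h
  · exact hN.cond_success_of_le_two hξ hNo hγ hr0 hlam hα hα' t htr (fun ω h => h) h
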